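/- All logarithms are to base 2. For an integer $k\ge 1$ let $\mathcal M_k$ be the set of monotonic probability vectors $\theta=(\theta_1,\dots,\theta_k)$, i.e. $\theta_1\ge\theta_2\ge\dots\ge\theta_k\ge 0$ and $\sum_i\theta_i=1$; such a $\theta$ generates i.i.d. sequences $X^n=(X_1,\dots,X_n)$ with $\Pr(X_t=i)=\theta_i$, $1\le i\le k$. A code for length $n$ is a prefix-free binary code on all sequences of $n$ positive integers (so it does not depend on $k$ or on $\theta$); if $L(x^n)$ is the length of the code word of $x^n$, its average per-symbol redundancy for $\theta\in\mathcal M_k$ is $$R_n(L,\theta)=\frac1n\,E_\theta L(X^n)-H(\theta),\qquad H(\theta)=-\sum_{i=1}^k\theta_i\log\theta_i .$$ **Theorem.** Fix $\varepsilon>0$. There exist codes for all lengths $n$, with length functions $L^*=L^*_n$, such that the following three statements hold. 1. For all sufficiently large $n$, for all integers $k$ with $2\le k\le n^{1/3}$ and all $\theta\in\mathcal M_k$, $$R_n(L^*,\theta)\le(1+\varepsilon)\,\frac{k-1}{2n}\,\log\frac{n(\log n)^2}{k^3}.$$ 2. For every sequence of integers $k=k_n$ with $k_n>n^{1/3}$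 for all large $n$ and $k_n=o(n)$, for all sufficiently large $n$ and all $\theta\in\mathcal M_{k_n}$, $$R_n(L^*,\theta)\le(1+\varepsilon)(\log n)\Bigl(\log\frac{k_n}{n^{1/3-\varepsilon}}\Bigr)\frac{n^{1/3}}{n}.$$ 3. For every sequence of integers $k=k_n$ with $k_n>n^{1/3}$ for all large $n$ and $k_n=O(n)$, for all sufficiently large $n$ and all $\theta\in\mathcal M_{k_n}$, $$R_n(L^*,\theta)\le(1+\varepsilon)\,\frac23\,(\log n)^2\,\frac{n^{1/3}}{n}.$$ -/

import Mathlib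

open Filter Asymptotics

/-- The class of monotonic sources over an alphabet of size `k`: probability vectors
`θ₁ ≥ θ₂ ≥ … ≥ θ_k` (indexed from `0`; the letter with index `i` is the positive integer `i + 1`). -/
def MonotonicSources (k : ℕ) : Set (Fin k → ℝ) :=
  {θ | θ ∈ stdSimplex ℝ (Fin k) ∧ Antitone θ}

/-- A binary prefix-free block code for sequences of `n` positive integers. The code accepts all
sequences of positive integers, so it does not know the alphabet size of the source. -/
structure BlockCode (n : ℕ) where
  /-- The code word of a sequence. -/
  encode : (Fin n → ℕ+) → List Bool
  prefixFree : ∀ x y, encode x <+: encode y → x = y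

/-- The length function `L` of a block code. -/
def BlockCode.length {n : ℕ} (C : BlockCode n) (x : Fin n → ℕ+) : ℕ :=
  (C.encode x).length

/-- The sequence of positive integers in `{1, …, k}` with the given letter indices. -/
def toLetters {n k : ℕ} (x : Fin n → Fin k) : Fin n → ℕ+ :=
  fun t => Nat.succPNat (x t : ℕ)

/-- The probability of a sequence of `n` letters generated i.i.d. by `θ`. -/
noncomputable def seqProb {n k : ℕ} (θ : Fin k → ℝ) (x : Fin n → Fin k) : ℝ :=
  ∏ t, θ (x t)

/-- The expected code length, in bits, of a sequence of length `n` generated i.i.d. by `θ`. -/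
noncomputable def expectedLength {n k : ℕ} (C : BlockCode n) (θ : Fin k → ℝ) : ℝ :=
  ∑ x : Fin n → Fin k, seqProb θ x * (C.length (toLetters x) : ℝ)

/-- The entropy of `θ` in bits (the term of a letter of probability `0` is `0`). -/
noncomputable def entropyBits {k : ℕ} (θ : Fin k → ℝ) : ℝ :=
  -∑ i, θ i * Real.logb 2 (θ i)

/-- The average per-symbol redundancy `R_n(L, θ)`. -/
noncomputable def redundancy {n k : ℕ} (C : BlockCode n) (θ : Fin k → ℝ) : ℝ :=
  1 / (n : ℝ) * expectedLength C θ - entropyBits θ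

/-! A uniform mixture of finitely many i.i.d. sources, turned into a prefix code, loses only `log
|F| + O(1)` bits against each of them. If the true source is `θ` and `q` is in the family, the
remaining loss is `n` times a divergence, which the chi-square distance bounds. Mixing also over `k`
with weights `1 / (k (k + 1))` gives one code for all alphabets. It remains to cover the monotonic
sources by few vectors.

With the grid of squares `j ^ 2 / n` each letter contributes `O(1 / n)` to the chi-square distance.
For small `k` the scale is free, so only `k - 1` coordinates are rounded
(`exists_chiSqCover_of_fixed_dimension`). For larger `k ≤ n^{1/3}` the rounded square roots form a
partition of an integer at most `√(k n)` into at most `k` parts, and counting these yields `(k / 2)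
log (n / k ^ 3) + O(k)` bits (`exists_chiSqCover_of_cube_le`).

For `k > n^{1/3}` values are rounded up to geometric levels of ratio `1 + Γ n^{-1/3}`; by
monotonicity one threshold index per level determines the result (`exists_chiSqCover_of_levels`).
The cost is `n^{1/3} (18 / Γ · log ^ 2 n + O(log n) + 2 Γ ^ 2)`, so a large fixed `Γ` makes it at
most `η n^{1/3} log ^ 2 n` for any prescribed `η > 0`. Both bounds for large alphabets follow from
this. -/

/-! ### Prefix-free codes from subprobabilities -/

/-- The number in `[0, 1)` whose binary expansion is given by a list of bits. -/
noncomputable def binaryFraction : List Bool → ℝ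
  | [] => 0
  | b :: l => ((if b then 1 else 0) + binaryFraction l) / 2

theorem binaryFraction_nonneg (l : List Bool) : 0 ≤ binaryFraction l := by
  induction l with
  | nil => simp [binaryFraction]
  | cons b l ih => cases b <;> simp [binaryFraction] <;> positivity

theorem binaryFraction_lt_one (l : List Bool) : binaryFraction l < 1 := by
  induction l with
  | nil => simp [binaryFraction]
  | cons b l ih => cases b <;> simp [binaryFraction] <;> linarith

theorem binaryFraction_append (l t : List Bool) :
    binaryFraction (l ++ t) = binaryFraction l + binaryFraction t / 2 ^ l.length := by
  induction l with
  | nil => simp [binaryFraction]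
  | cons b l ih =>
    simp only [List.cons_append, binaryFraction, ih, List.length_cons, pow_succ]
    field_simp
    ring

theorem exists_binaryFraction_eq (ℓ m : ℕ) (hm : m < 2 ^ ℓ) :
    ∃ l : List Bool, l.length = ℓ ∧ binaryFraction l = m / 2 ^ ℓ := by
  induction ℓ generalizing m with
  | zero =>
    obtain rfl : m = 0 := by simpa using hm
    exact ⟨[], by simp [binaryFraction]⟩
  | succ ℓ ih =>
    rcases lt_or_ge m (2 ^ ℓ) with h | h
    · obtain ⟨l, hl, hv⟩ := ih m h
      refine ⟨false :: l, by simp [hl], ?_⟩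
      simp only [binaryFraction, hv, pow_succ]
      field_simp
      simp
    · obtain ⟨l, hl, hv⟩ := ih (m - 2 ^ ℓ) (by rw [pow_succ] at hm; omega)
      refine ⟨true :: l, by simp [hl], ?_⟩
      simp only [binaryFraction, hv, pow_succ]
      push_cast [h]
      field_simp
      simp

/-- Words of length `ℓ` with `2 ^ (-ℓ) ≤ p / 2` suffice: rounding `s` up to the dyadic grid costs
less than one cell, and the next whole cell still fits below `s + p`. -/
theorem exists_binaryFraction_mem (s p : ℝ) (hs : 0 ≤ s) (hp : 0 < p) (hsp : s + p ≤ 1) :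
    ∃ l : List Bool, (l.length : ℝ) ≤ 2 - Real.logb 2 p ∧
      s ≤ binaryFraction l ∧ binaryFraction l + 1 / 2 ^ l.length ≤ s + p := by
  have hlog : Real.logb 2 p ≤ 0 := Real.logb_nonpos (by norm_num) hp.le (by linarith)
  set ℓ := ⌈1 - Real.logb 2 p⌉₊ with hℓ
  have hle : 1 - Real.logb 2 p ≤ ℓ := Nat.le_ceil _
  have hlt : (ℓ : ℝ) < 1 - Real.logb 2 p + 1 := Nat.ceil_lt_add_one (by linarith)
  have hpos : (0 : ℝ) < 2 ^ ℓ := by positivity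
  have h2 : 2 ≤ p * 2 ^ ℓ := by
    have h : Real.logb 2 (2 / p) ≤ ℓ := by
      rw [Real.logb_div (by norm_num) hp.ne', Real.logb_self_eq_one (by norm_num)]
      exact hle
    rw [Real.logb_le_iff_le_rpow (by norm_num) (by positivity), Real.rpow_natCast,
      div_le_iff₀ hp] at h
    linarith
  have hm1 : s * 2 ^ ℓ ≤ ⌈s * 2 ^ ℓ⌉₊ := Nat.le_ceil _
  have hm2 : (⌈s * 2 ^ ℓ⌉₊ : ℝ) < s * 2 ^ ℓ + 1 := Nat.ceil_lt_add_one (by positivity)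
  have hm3 : (⌈s * 2 ^ ℓ⌉₊ : ℝ) + 1 ≤ (s + p) * 2 ^ ℓ := by nlinarith
  have hm4 : (⌈s * 2 ^ ℓ⌉₊ : ℝ) < 2 ^ ℓ := by nlinarith
  obtain ⟨l, hl, hv⟩ := exists_binaryFraction_eq ℓ ⌈s * 2 ^ ℓ⌉₊ (by exact_mod_cast hm4)
  refine ⟨l, ?_, ?_, ?_⟩
  · rw [hl]; linarith
  · rw [hv, le_div_iff₀ hpos]; exact hm1
  · rw [hv, hl, ← add_div, div_le_iff₀ hpos]; exact hm3

/-- A converse of Kraft's inequality in Shannon's form: a positive subprobability on a countable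
type has a prefix-free binary code with lengths at most `2 - log P`. -/
theorem exists_prefixFree_code {α : Type*} [Encodable α] (P : α → ℝ) (hP : ∀ x, 0 < P x)
    (hsum : ∀ s : Finset α, ∑ x ∈ s, P x ≤ 1) :
    ∃ c : α → List Bool, (∀ x y, c x <+: c y → x = y) ∧
      ∀ x, ((c x).length : ℝ) ≤ 2 - Real.logb 2 (P x) := by
  classical
  have hfin (x : α) : {y : α | Encodable.encode y < Encodable.encode x}.Finite :=
    (Set.finite_Iio (Encodable.encode x)).preimage Encodable.encode_injective.injOn
  -- Shannon–Fano–Elias coding: the intervals from `S x` to `S x + P x` are disjoint, and each code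
  -- word is a dyadic cell inside its interval.
  set S : α → ℝ := fun x => ∑ y ∈ (hfin x).toFinset, P y with hS
  have hins (x : α) : S x + P x = ∑ y ∈ insert x (hfin x).toFinset, P y := by
    rw [Finset.sum_insert (by simp), add_comm]
  choose c hlen hlow hup using fun x => exists_binaryFraction_mem (S x) (P x)
    (Finset.sum_nonneg fun y _ => (hP y).le) (hP x) ((hins x).trans_le (hsum _))
  have hmono (x y : α) (h : Encodable.encode x < Encodable.encode y) : S x + P x ≤ S y := by
    rw [hins]
    refine Finset.sum_le_sum_of_subset_of_nonneg ?_ fun z _ _ => (hP z).le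
    intro z hz
    rcases Finset.mem_insert.1 hz with rfl | hz
    · simpa using h
    · simp only [Set.Finite.mem_toFinset, Set.mem_ofPred_eq] at hz ⊢
      exact hz.trans h
  refine ⟨c, fun x y hxy => ?_, hlen⟩
  obtain ⟨t, ht⟩ := hxy
  have hpos : (0 : ℝ) < 2 ^ (c x).length := by positivity
  have hpos' : (0 : ℝ) < 1 / 2 ^ (c y).length := by positivity
  -- If `c x` is a prefix of `c y`, the point of `c y` lies in the cell of `c x`, hence in the
  -- intervals of both `x` and `y`.
  have hv := binaryFraction_append (c x) t
  rw [ht] at hv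
  have h1 : 0 ≤ binaryFraction t / 2 ^ (c x).length :=
    div_nonneg (binaryFraction_nonneg t) hpos.le
  have h2 : binaryFraction t / 2 ^ (c x).length < 1 / 2 ^ (c x).length :=
    div_lt_div_of_pos_right (binaryFraction_lt_one t) hpos
  have hlx := hlow x
  have hly := hlow y
  have hux := hup x
  have huy := hup y
  rcases lt_trichotomy (Encodable.encode x) (Encodable.encode y) with h | h | h
  · linarith [hmono x y h]
  · exact Encodable.encode_injective h
  · linarith [hmono y x h]

/-- Every weighted finite list of sequences has a block code whose lengths on the list are governed
by the weights. -/
theorem BlockCode.exists_length_le {n : ℕ} {ι : Type*} (s : Finset ι) (g : ι → Fin n → ℕ+)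
    (v : ι → ℝ) (hv : ∀ a ∈ s, 0 ≤ v a) (hsum : ∑ a ∈ s, v a ≤ 1) :
    ∃ C : BlockCode n, ∀ a ∈ s, 0 < v a → (C.length (g a) : ℝ) ≤ 3 - Real.logb 2 (v a) := by
  classical
  let _ :  Encodable (Fin n → ℕ+) := Encodable.ofCountable _
  -- The geometric half makes every sequence positive, so that all sequences receive a code word;
  -- halving the weights costs one bit, whence `3` instead of `2`.
  set P : (Fin n → ℕ+) → ℝ := fun x =>
    (1 / 2) * (1 / 2) ^ (Encodable.encode x + 1) + (1 / 2) * ∑ a ∈ s, if g a = x then v a else 0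
    with hPdef
  have hmix (x) : 0 ≤ ∑ a ∈ s, if g a = x then v a else 0 :=
    Finset.sum_nonneg fun a ha => by split_ifs <;> simp [hv a ha]
  have hP (x) : 0 < P x := by
    have := hmix x
    positivity
  obtain ⟨c, hc, hlen⟩ := exists_prefixFree_code P hP fun t => by
    have h1 : ∑ x ∈ t, ((1 : ℝ) / 2) ^ (Encodable.encode x + 1) ≤ 1 := by
      have h := (summable_geometric_two).sum_le_tsum (t.image Encodable.encode)
        (fun _ _ => by positivity)
      rw [tsum_geometric_two, Finset.sum_image Encodable.encode_injective.injOn] at h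
      simp only [pow_succ, ← Finset.sum_mul]
      linarith
    have h2 : ∑ x ∈ t, ∑ a ∈ s, (if g a = x then v a else 0) ≤ 1 := by
      rw [Finset.sum_comm]
      refine (Finset.sum_le_sum fun a ha => ?_).trans hsum
      rw [Finset.sum_ite_eq]
      split_ifs <;> simp [hv a ha]
    simp only [hPdef, Finset.sum_add_distrib, ← Finset.mul_sum]
    linarith
  refine ⟨⟨c, hc⟩, fun a ha hpos => ?_⟩
  refine (hlen (g a)).trans ?_
  have hle : v a / 2 ≤ P (g a) := by
    have h := Finset.single_le_sum (f := fun b => if g b = g a then v b else 0) (fun b hb => by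
      show (0 : ℝ) ≤ if g b = g a then v b else 0
      split_ifs <;> simp [hv b hb]) ha
    simp only [if_true] at h
    have : (0 : ℝ) ≤ (1 / 2) * (1 / 2) ^ (Encodable.encode (g a) + 1) := by positivity
    simp only [hPdef]
    linarith
  have hl := Real.logb_le_logb_of_le (b := 2) (by norm_num) (by positivity) hle
  rw [Real.logb_div hpos.ne' (by norm_num), Real.logb_self_eq_one (by norm_num)] at hl
  linarith

/-! ### Redundancy of mixture codes and chi-square distance -/

theorem sum_seqProb {n k : ℕ} (θ : Fin k → ℝ) :
    ∑ x : Fin n → Fin k, seqProb θ x = (∑ i, θ i) ^ n := by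
  simp only [seqProb]
  rw [← Fintype.piFinset_univ, ← Finset.prod_univ_sum]
  simp

theorem sum_seqProb_mul_sum {n k : ℕ} (θ f : Fin k → ℝ) (hθ : ∑ i, θ i = 1) :
    ∑ x : Fin n → Fin k, seqProb θ x * ∑ t, f (x t) = n * ∑ i, θ i * f i := by
  simp only [Finset.mul_sum]
  rw [Finset.sum_comm]
  have h (t : Fin n) : ∑ x : Fin n → Fin k, seqProb θ x * f (x t) = ∑ i, θ i * f i := by
    -- Placing `f` in the factor of coordinate `t` alone makes the summand a product over
    -- coordinates, so the sum factorizes.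
    have h1 (x : Fin n → Fin k) : seqProb θ x * f (x t)
        = ∏ s, (θ (x s) * if s = t then f (x s) else 1) := by
      rw [Finset.prod_mul_distrib, Finset.prod_ite_eq' Finset.univ t (fun s => f (x s))]
      simp [seqProb]
    simp only [h1]
    rw [← Fintype.piFinset_univ,
      ← Finset.prod_univ_sum (fun _ => Finset.univ) (fun s i => θ i * if s = t then f i else 1),
      Finset.prod_eq_single t]
    · simp
    · intro s _ hs
      simp [hs, hθ]
    · simp
  simp [h, ← Finset.mul_sum]

/-- The divergence of a probability vector from the normalization of a positive vector `q` is at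
most the chi-square distance to `q` itself. -/
theorem sum_mul_log_sub_log_le {ι : Type*} [Fintype ι] (θ q : ι → ℝ) (h0 : ∀ i, 0 ≤ θ i)
    (hθ : ∑ i, θ i = 1) (hq : ∀ i, 0 < q i) :
    ∑ i, θ i * (Real.log (θ i) - Real.log (q i / ∑ j, q j)) ≤ ∑ i, (θ i - q i) ^ 2 / q i := by
  have hne : Nonempty ι := by
    by_contra h
    rw [not_nonempty_iff] at h
    simp at hθ
  have hZ : 0 < ∑ j, q j := Finset.sum_pos (fun i _ => hq i) Finset.univ_nonempty
  -- The inequality `log u ≤ u - 1` is used at `u = θ i / q i` here and at `u = ∑ q` at the end,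
  -- where the surplus `1 - ∑ q + log (∑ q)` is seen to be nonpositive.
  have hterm (i : ι) : θ i * (Real.log (θ i) - Real.log (q i / ∑ j, q j)) ≤
      (θ i - q i) ^ 2 / q i + θ i - q i + θ i * Real.log (∑ j, q j) := by
    rw [Real.log_div (hq i).ne' hZ.ne']
    have hid : (θ i - q i) ^ 2 / q i + θ i - q i = θ i * (θ i / q i - 1) := by
      field_simp [(hq i).ne']
      ring
    rw [hid]
    rcases (h0 i).eq_or_lt with h | h
    · simp [← h]
    · have := Real.log_le_sub_one_of_pos (div_pos h (hq i))
      rw [Real.log_div h.ne' (hq i).ne'] at this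
      nlinarith
  refine (Finset.sum_le_sum fun i _ => hterm i).trans ?_
  rw [Finset.sum_add_distrib, Finset.sum_sub_distrib, Finset.sum_add_distrib, ← Finset.sum_mul, hθ]
  linarith [Real.log_le_sub_one_of_pos hZ]

/-- The redundancy of a code that is nearly as short as the ideal code of the normalization
of a positive vector `q`. -/
theorem mul_redundancy_le {n k : ℕ} (hn : 0 < n) (C : BlockCode n) (b : ℝ) (q θ : Fin k → ℝ)
    (hq : ∀ i, 0 < q i) (hθ : θ ∈ stdSimplex ℝ (Fin k))
    (hC : ∀ x : Fin n → Fin k,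
      (C.length (toLetters x) : ℝ) ≤ b - Real.logb 2 (seqProb (fun i => q i / ∑ j, q j) x)) :
    n * redundancy C θ ≤ b + n / Real.log 2 * ∑ i, (θ i - q i) ^ 2 / q i := by
  obtain ⟨h0, h1⟩ := hθ
  have hn' : (0 : ℝ) < n := by exact_mod_cast hn
  have hl2 : 0 < Real.log 2 := Real.log_pos (by norm_num)
  have hne : Nonempty (Fin k) := by
    by_contra h
    rw [not_nonempty_iff] at h
    simp at h1
  have hZ : 0 < ∑ j, q j := Finset.sum_pos (fun i _ => hq i) Finset.univ_nonempty
  set φ : Fin k → ℝ := fun i => q i / ∑ j, q j with hφ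
  have hφ0 (i) : φ i ≠ 0 := (div_pos (hq i) hZ).ne'
  have hE : expectedLength C θ ≤ b - n * ∑ i, θ i * Real.logb 2 (φ i) := by
    have hx (x : Fin n → Fin k) : seqProb θ x * (C.length (toLetters x) : ℝ)
        ≤ seqProb θ x * b - seqProb θ x * ∑ t, Real.logb 2 (φ (x t)) := by
      rw [← mul_sub]
      refine mul_le_mul_of_nonneg_left ?_ (Finset.prod_nonneg fun t _ => h0 _)
      refine (hC x).trans_eq ?_
      rw [seqProb, Real.logb_prod _ _ fun t _ => hφ0 _]
    refine (Finset.sum_le_sum fun x _ => hx x).trans_eq ?_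
    rw [Finset.sum_sub_distrib, ← Finset.sum_mul, sum_seqProb, h1,
      sum_seqProb_mul_sum θ (fun i => Real.logb 2 (φ i)) h1]
    simp
  have hD := sum_mul_log_sub_log_le θ q h0 h1 hq
  have hR : n * redundancy C θ = expectedLength C θ + n * ∑ i, θ i * Real.logb 2 (θ i) := by
    rw [redundancy, entropyBits]
    field_simp
    ring
  have hconv : ∑ i, θ i * Real.logb 2 (θ i) - ∑ i, θ i * Real.logb 2 (φ i)
      = (∑ i, θ i * (Real.log (θ i) - Real.log (φ i))) / Real.log 2 := by
    rw [← Finset.sum_sub_distrib, Finset.sum_div]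
    refine Finset.sum_congr rfl fun i _ => ?_
    rw [Real.logb, Real.logb]
    ring
  calc n * redundancy C θ
      ≤ b + n * (∑ i, θ i * Real.logb 2 (θ i) - ∑ i, θ i * Real.logb 2 (φ i)) := by
        rw [hR]; linarith
    _ = b + n / Real.log 2 * ∑ i, θ i * (Real.log (θ i) - Real.log (φ i)) := by rw [hconv]; ring
    _ ≤ _ := by gcongr

/-- A code adapted to a finite family of positive vectors for every alphabet size up to `K`. -/
theorem BlockCode.exists_redundancy_le {n : ℕ} (hn : 0 < n) (K : ℕ)
    (F : (k : ℕ) → Finset (Fin k → ℝ)) (hF : ∀ k, ∀ q ∈ F k, ∀ i, 0 < q i) :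
    ∃ C : BlockCode n, ∀ k, k ≤ K → ∀ q ∈ F k, ∀ c > 0, ∀ θ ∈ stdSimplex ℝ (Fin k),
      n * redundancy C θ ≤ 3 + Real.logb 2 (k * (k + 1)) + Real.logb 2 (F k).card +
        n / Real.log 2 * ∑ i, (θ i - c * q i) ^ 2 / (c * q i) := by
  classical
  have hweights (K : ℕ) : ∑ k ∈ Finset.Icc 1 K, (1 : ℝ) / (k * (k + 1)) = 1 - 1 / (K + 1) := by
    induction K with
    | zero => simp
    | succ K ih =>
      rw [Finset.sum_Icc_succ_top (by omega), ih]
      push_cast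
      field_simp
      ring
  let s : Finset (Σ k : ℕ, (Fin k → ℝ) × (Fin n → Fin k)) :=
    (Finset.Icc 1 K).sigma fun k => F k ×ˢ Finset.univ
  let g : (Σ k : ℕ, (Fin k → ℝ) × (Fin n → Fin k)) → Fin n → ℕ+ := fun a => toLetters a.2.2
  let v : (Σ k : ℕ, (Fin k → ℝ) × (Fin n → Fin k)) → ℝ := fun a =>
    1 / ((a.1 : ℝ) * (a.1 + 1)) * (1 / ((F a.1).card : ℝ) *
      seqProb (fun i => a.2.1 i / ∑ j, a.2.1 j) a.2.2)
  obtain ⟨C, hC⟩ := BlockCode.exists_length_le s g v (by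
    rintro ⟨k, q, x⟩ ha
    simp only [s, Finset.mem_sigma, Finset.mem_product, Finset.mem_univ, and_true] at ha
    refine mul_nonneg (by positivity) (mul_nonneg (by positivity)
      (Finset.prod_nonneg fun t _ => div_nonneg (hF k q ha.2 _).le
        (Finset.sum_nonneg fun j _ => (hF k q ha.2 j).le))))
    (by
      rw [Finset.sum_sigma]
      refine (Finset.sum_le_sum (g := fun k : ℕ => (1 : ℝ) / (k * (k + 1))) fun k hk => ?_).trans
        ((hweights K).trans_le (sub_le_self _ (by positivity)))
      simp only [v]
      rw [← Finset.mul_sum]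
      refine mul_le_of_le_one_right (by positivity) ?_
      rw [Finset.sum_product]
      simp only [← Finset.mul_sum]
      have h1 (q) (hq : q ∈ F k) :
          ∑ x : Fin n → Fin k, seqProb (fun i => q i / ∑ j, q j) x = 1 := by
        rw [sum_seqProb]
        have hk1 : 1 ≤ k := (Finset.mem_Icc.1 hk).1
        have : Nonempty (Fin k) := ⟨⟨0, hk1⟩⟩
        rw [← Finset.sum_div, div_self, one_pow]
        exact (Finset.sum_pos (fun i _ => hF k q hq i) Finset.univ_nonempty).ne'
      rw [Finset.sum_congr rfl h1]
      simp only [Finset.sum_const, nsmul_eq_mul, mul_one, one_div]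
      exact inv_mul_le_one)
  refine ⟨C, fun k hk q hq c hc θ hθ => mul_redundancy_le hn C _ (fun i => c * q i) θ
    (fun i => mul_pos hc (hF k q hq i)) hθ fun x => ?_⟩
  -- Normalization cancels `c`, so the code need not know the scale.
  simp only [← Finset.mul_sum, mul_div_mul_left _ _ hc.ne']
  have hk1 : 1 ≤ k := by
    by_contra h
    obtain rfl : k = 0 := by omega
    simpa using hθ.2
  have hk0 : (0 : ℝ) < k := by exact_mod_cast hk1
  have : Nonempty (Fin k) := ⟨⟨0, hk1⟩⟩
  have hZ : 0 < ∑ j, q j := Finset.sum_pos (fun i _ => hF k q hq i) Finset.univ_nonempty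
  have hp : 0 < seqProb (fun i => q i / ∑ j, q j) x :=
    Finset.prod_pos fun t _ => div_pos (hF k q hq _) hZ
  have hcard : (0 : ℝ) < (F k).card := by exact_mod_cast Finset.card_pos.2 ⟨q, hq⟩
  have h := hC ⟨k, q, x⟩ (by simp [s, hk, hk1, hq]) (by simp only [v]; positivity)
  simp only [g, v] at h
  rw [Real.logb_mul (by positivity) (by positivity), Real.logb_mul (by positivity) hp.ne',
    one_div, one_div, Real.logb_inv, Real.logb_inv] at h
  linarith

/-! ### Chi-square covers of the monotonic sources -/

/-- A finite family of positive vectors that approximates, up to scaling, every monotonic source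
over `k` letters within chi-square distance `δ`. -/
def IsChiSqCover {k : ℕ} (F : Finset (Fin k → ℝ)) (δ : ℝ) : Prop :=
  (∀ q ∈ F, ∀ i, 0 < q i) ∧ ∀ θ ∈ MonotonicSources k, ∃ q ∈ F, ∃ c > 0,
    ∑ i, (θ i - c * q i) ^ 2 / (c * q i) ≤ δ

/-- Near `b` the grid of squares has spacing about `2 √(b / m)`, so squared error over `b` is
uniformly `O(1 / m)`. Rounding up keeps the grid point positive even at `a = 0`. -/
theorem sq_sub_div_grid_le (a m : ℝ) (ha : 0 ≤ a) (hm : 0 < m) :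
    (a - ((⌊√(m * a)⌋₊ : ℝ) + 1) ^ 2 / m) ^ 2 / (((⌊√(m * a)⌋₊ : ℝ) + 1) ^ 2 / m) ≤ 4 / m := by
  have h1 : (⌊√(m * a)⌋₊ : ℝ) ≤ √(m * a) := Nat.floor_le (Real.sqrt_nonneg _)
  have h2 : √(m * a) < (⌊√(m * a)⌋₊ : ℝ) + 1 := Nat.lt_floor_add_one _
  have h3 : √(m * a) ^ 2 = m * a := Real.sq_sqrt (by positivity)
  set j : ℝ := ((⌊√(m * a)⌋₊ : ℕ) : ℝ) with hj
  have hj0 : 0 ≤ j := Nat.cast_nonneg _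
  set s := √(m * a) with hs
  have hs0 : 0 ≤ s := Real.sqrt_nonneg _
  have hb0 : 0 ≤ (j + 1) ^ 2 - m * a := by nlinarith
  have hb1 : (j + 1) ^ 2 - m * a ≤ 2 * (j + 1) := by nlinarith
  have hsq : ((j + 1) ^ 2 - m * a) ^ 2 ≤ 4 * (j + 1) ^ 2 := by nlinarith
  have hid : (a - (j + 1) ^ 2 / m) ^ 2 / ((j + 1) ^ 2 / m)
      = ((j + 1) ^ 2 - m * a) ^ 2 / ((j + 1) ^ 2 * m) := by
    field_simp
    ring
  rw [hid, div_le_div_iff₀ (by positivity) hm]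
  nlinarith

/-- Dividing by the largest entry `θ 0` makes the first coordinate exactly `1` and the others at
most `1`. The free scale `c = θ 0` thus saves one coordinate, which gives the factor `k - 1` for
bounded `k`. -/
theorem exists_chiSqCover_of_fixed_dimension (m n : ℕ) (hn : 0 < n) :
    ∃ F : Finset (Fin (m + 1) → ℝ), IsChiSqCover F (4 * m / n) ∧
      (F.card : ℝ) ≤ (√n + 1) ^ m := by
  classical
  have hn' : (0 : ℝ) < n := by exact_mod_cast hn
  let G : (Fin m → ℕ) → Fin (m + 1) → ℝ :=
    fun j => Fin.cons 1 fun i => ((j i : ℝ) + 1) ^ 2 / n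
  refine ⟨(Fintype.piFinset fun _ : Fin m => Finset.range (⌊√(n : ℝ)⌋₊ + 1)).image G,
    ⟨?_, ?_⟩, ?_⟩
  · intro q hq i
    obtain ⟨j, -, rfl⟩ := Finset.mem_image.1 hq
    refine Fin.cases ?_ (fun i => ?_) i
    · simp [G]
    · simp only [G, Fin.cons_succ]
      positivity
  · rintro θ ⟨⟨h0, h1⟩, hanti⟩
    have hle (i) : θ i ≤ θ 0 := hanti (Fin.zero_le i)
    have hpos : 0 < θ 0 := by
      by_contra h
      have : ∑ i, θ i ≤ 0 := Finset.sum_nonpos fun i _ => (hle i).trans (not_lt.1 h)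
      linarith
    have hθ0 : θ 0 ≤ 1 := h1 ▸ Finset.single_le_sum (fun i _ => h0 i) (Finset.mem_univ 0)
    refine ⟨G fun i => ⌊√(n * (θ i.succ / θ 0))⌋₊, Finset.mem_image_of_mem _ ?_, θ 0, hpos, ?_⟩
    · rw [Fintype.mem_piFinset]
      intro i
      rw [Finset.mem_range, Nat.lt_succ_iff]
      refine Nat.floor_mono (Real.sqrt_le_sqrt ?_)
      exact mul_le_of_le_one_right hn'.le ((div_le_one hpos).2 (hle _))
    · rw [Fin.sum_univ_succ]
      simp only [G, Fin.cons_zero, Fin.cons_succ, mul_one, sub_self]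
      have hterm (i : Fin m) : (θ i.succ - θ 0 * (((⌊√(n * (θ i.succ / θ 0))⌋₊ : ℝ) + 1) ^ 2 / n)) ^ 2
          / (θ 0 * (((⌊√(n * (θ i.succ / θ 0))⌋₊ : ℝ) + 1) ^ 2 / n)) ≤ 4 / n := by
        have h := sq_sub_div_grid_le (θ i.succ / θ 0) n (div_nonneg (h0 _) hpos.le) hn'
        set r := ((⌊√(n * (θ i.succ / θ 0))⌋₊ : ℝ) + 1) ^ 2 / n with hr
        have hr0 : 0 < r := by positivity
        have hid : (θ i.succ - θ 0 * r) ^ 2 / (θ 0 * r)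
            = θ 0 * ((θ i.succ / θ 0 - r) ^ 2 / r) := by
          field_simp
        rw [hid]
        calc θ 0 * ((θ i.succ / θ 0 - r) ^ 2 / r) ≤ 1 * (4 / n) := by gcongr
          _ = 4 / n := one_mul _
      have hsum := Finset.sum_le_sum fun i (_ : i ∈ Finset.univ) => hterm i
      simp only [Finset.sum_const, Finset.card_univ, Fintype.card_fin, nsmul_eq_mul] at hsum
      rw [show (4 * m / n : ℝ) = m * (4 / n) by ring]
      simpa using hsum
  · have h := (Finset.card_image_le (s := Fintype.piFinset fun _ : Fin m =>
      Finset.range (⌊√(n : ℝ)⌋₊ + 1)) (f := G))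
    simp only [Fintype.card_piFinset, Finset.card_range, Finset.prod_const, Finset.card_univ,
      Fintype.card_fin] at h
    have h' : ((Finset.image G (Fintype.piFinset fun _ : Fin m =>
      Finset.range (⌊√(n : ℝ)⌋₊ + 1))).card : ℝ) ≤ ((⌊√(n : ℝ)⌋₊ : ℝ) + 1) ^ m := by
      exact_mod_cast h
    refine h'.trans ?_
    gcongr
    exact Nat.floor_le (Real.sqrt_nonneg _)

theorem sum_exp_neg_mul_le (x : ℝ) (hx : 0 < x) (M : ℕ) :
    ∑ d ∈ Finset.range M, Real.exp (-(x * d)) ≤ 1 + 1 / x := by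
  have hr : Real.exp (-x) ≤ 1 / (1 + x) := by
    rw [Real.exp_neg, ← one_div]
    exact one_div_le_one_div_of_le (by linarith) (by linarith [Real.add_one_le_exp x])
  have hpow (d : ℕ) : Real.exp (-(x * d)) = Real.exp (-x) ^ d := by
    rw [← Real.exp_nat_mul]
    ring_nf
  simp only [hpow]
  have hg := geom_sum_mul_neg (Real.exp (-x)) M
  have h0 : 0 ≤ Real.exp (-x) ^ M := by positivity
  have hs : 0 ≤ ∑ d ∈ Finset.range M, Real.exp (-x) ^ d :=
    Finset.sum_nonneg fun d _ => by positivity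
  have h1 : x / (1 + x) ≤ 1 - Real.exp (-x) := by
    have : x / (1 + x) = 1 - 1 / (1 + x) := by field_simp; ring
    linarith
  have h2 : (∑ d ∈ Finset.range M, Real.exp (-x) ^ d) * (x / (1 + x)) ≤ 1 := by nlinarith
  rw [← mul_div_assoc, div_le_one (by positivity)] at h2
  rw [show 1 + 1 / x = (1 + x) / x by field_simp; ring, le_div_iff₀ hx]
  exact h2

/-- The number of partitions of integers up to `S` into parts of size at most `k`,
given by the multiplicities of the parts. -/
theorem card_partitions_le (k M : ℕ) (S : ℝ) (hk : 0 < k) (hS : (k : ℝ) ^ 2 ≤ S) :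
    (((Fintype.piFinset fun _ : Fin k => Finset.range M).filter
      fun d => ∑ l : Fin k, ((l : ℕ) + 1 : ℝ) * d l ≤ S).card : ℝ) ≤
        (2 * Real.exp 2 * (S / k ^ 2)) ^ k := by
  have hk' : (0 : ℝ) < k := by exact_mod_cast hk
  have hS0 : 0 < S := lt_of_lt_of_le (by positivity) hS
  set T := (Fintype.piFinset fun _ : Fin k => Finset.range M).filter
      fun d => ∑ l : Fin k, ((l : ℕ) + 1 : ℝ) * d l ≤ S with hT
  -- Exponential tilting: with parameter `k / S` the constraint costs only a factor `exp k`, and the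
  -- sum over multiplicities becomes a product of geometric series.
  set x : Fin k → ℝ := fun l => ((l : ℕ) + 1 : ℝ) * (k / S) with hx
  have hx0 (l) : 0 < x l := by simp only [hx]; positivity
  have hone (d) (hd : d ∈ T) : 1 ≤ Real.exp k * ∏ l, Real.exp (-(x l * d l)) := by
    rw [← Real.exp_sum, ← Real.exp_add, Real.one_le_exp_iff]
    have h := (Finset.mem_filter.1 hd).2
    rw [Finset.sum_neg_distrib]
    have : ∑ l, x l * d l = (∑ l : Fin k, ((l : ℕ) + 1 : ℝ) * d l) * (k / S) := by
      rw [Finset.sum_mul]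
      exact Finset.sum_congr rfl fun l _ => by simp only [hx]; ring
    rw [this]
    have h2 : (∑ l : Fin k, ((l : ℕ) + 1 : ℝ) * d l) * (k / S) ≤ S * (k / S) := by gcongr
    rw [mul_div_cancel₀ _ hS0.ne'] at h2
    linarith
  -- The hypothesis `k ^ 2 ≤ S` gives `x l ≤ 1`, so the `1` is absorbed by doubling `1 / x l`.
  have hfactor (l : Fin k) : 1 + 1 / x l ≤ 2 * S / k * (1 / ((l : ℕ) + 1 : ℝ)) := by
    have hl : ((l : ℕ) + 1 : ℝ) ≤ k := by exact_mod_cast l.2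
    have h1 : 1 / x l = S / (((l : ℕ) + 1 : ℝ) * k) := by
      simp only [hx]
      field_simp
    have h2 : 1 ≤ S / (((l : ℕ) + 1 : ℝ) * k) := by
      rw [le_div_iff₀ (by positivity)]
      nlinarith
    have h3 : 2 * S / k * (1 / ((l : ℕ) + 1 : ℝ)) = 2 * (S / (((l : ℕ) + 1 : ℝ) * k)) := by
      field_simp
    rw [h1, h3]
    linarith
  have hfact : ∏ l : Fin k, (1 / ((l : ℕ) + 1 : ℝ)) = 1 / (k.factorial : ℝ) := by
    have hcast : (k.factorial : ℝ) = ∏ l ∈ Finset.range k, ((l : ℝ) + 1) := by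
      rw [← Finset.prod_range_add_one_eq_factorial]
      push_cast
      rfl
    rw [Fin.prod_univ_eq_prod_range (fun l => 1 / ((l : ℝ) + 1)) k, hcast]
    simp
  have hstir : 1 / (k.factorial : ℝ) ≤ (Real.exp 1 / k) ^ k := by
    have h := Real.pow_div_factorial_le_exp (k : ℝ) hk'.le k
    rw [div_pow, ← Real.exp_nat_mul, mul_one, le_div_iff₀ (by positivity)]
    calc 1 / (k.factorial : ℝ) * k ^ k = k ^ k / k.factorial := by ring
      _ ≤ _ := h
  calc (T.card : ℝ) = ∑ d ∈ T, 1 := by simp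
    _ ≤ ∑ d ∈ T, Real.exp k * ∏ l, Real.exp (-(x l * d l)) := Finset.sum_le_sum hone
    _ ≤ ∑ d ∈ Fintype.piFinset fun _ : Fin k => Finset.range M,
          Real.exp k * ∏ l, Real.exp (-(x l * d l)) :=
        Finset.sum_le_sum_of_subset_of_nonneg (Finset.filter_subset _ _)
          fun d _ _ => by positivity
    _ = Real.exp k * ∏ l, ∑ d ∈ Finset.range M, Real.exp (-(x l * d)) := by
        rw [← Finset.mul_sum, Finset.prod_univ_sum]
    _ ≤ Real.exp k * ∏ l : Fin k, (2 * S / k * (1 / ((l : ℕ) + 1 : ℝ))) := by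
        gcongr with l
        exact (sum_exp_neg_mul_le (x l) (hx0 l) M).trans (hfactor l)
    _ = Real.exp k * ((2 * S / k) ^ k * (1 / (k.factorial : ℝ))) := by
        rw [Finset.prod_mul_distrib, hfact, Finset.prod_const, Finset.card_univ, Fintype.card_fin]
    _ ≤ Real.exp k * ((2 * S / k) ^ k * (Real.exp 1 / k) ^ k) := by gcongr
    _ = _ := by
        rw [show (k : ℝ) = k * 1 by ring, Real.exp_nat_mul, mul_one, ← mul_pow, ← mul_pow,
          show (2 : ℝ) = 1 + 1 by norm_num, Real.exp_add]
        congr 1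
        field_simp

theorem sum_range_ite_sub_of_antitone {J : ℕ → ℕ} (hJ : Antitone J) (i K : ℕ) :
    ∑ l ∈ Finset.range K, (if i ≤ l then J l - J (l + 1) else 0) = J i - J (max i K) := by
  induction K with
  | zero => simp
  | succ K ih =>
    rw [Finset.sum_range_succ, ih]
    split_ifs with h
    · have h1 := hJ h
      have h2 : J (K + 1) ≤ J K := hJ (Nat.le_succ K)
      have h3 : max i K = K := max_eq_right h
      have h4 : max i (K + 1) = K + 1 := max_eq_right (by omega)
      rw [h3, h4]
      omega
    · rw [max_eq_left (by omega), max_eq_left (by omega)]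
      simp

/-- The integers `⌊√(n θ i)⌋` decrease in `i`, so their successive differences `d l` are the
multiplicities of the part `l + 1` in the conjugate partition. The condition `k ^ 3 ≤ n` is what the
counting bound needs for `S = √(k n)`. -/
theorem exists_chiSqCover_of_cube_le (k n : ℕ) (hk : 0 < k) (hkn : k ^ 3 ≤ n) :
    ∃ F : Finset (Fin k → ℝ), IsChiSqCover F (4 * k / n) ∧
      (F.card : ℝ) ≤ (2 * Real.exp 2 * (√(k * n) / k ^ 2)) ^ k := by
  classical
  have hk' : (0 : ℝ) < k := by exact_mod_cast hk
  have hn : 0 < n := lt_of_lt_of_le (by positivity) hkn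
  have hn' : (0 : ℝ) < n := by exact_mod_cast hn
  have hkn' : (k : ℝ) ^ 3 ≤ n := by exact_mod_cast hkn
  have hS : (k : ℝ) ^ 2 ≤ √(k * n) := by
    refine Real.le_sqrt_of_sq_le ?_
    nlinarith
  let G : (Fin k → ℕ) → Fin k → ℝ :=
    fun d i => (((∑ l : Fin k, if (i : ℕ) ≤ l then d l else 0 : ℕ) : ℝ) + 1) ^ 2 / n
  set T := (Fintype.piFinset fun _ : Fin k => Finset.range (⌊√(n : ℝ)⌋₊ + 1)).filter
      fun d => ∑ l : Fin k, ((l : ℕ) + 1 : ℝ) * d l ≤ √(k * n) with hT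
  refine ⟨T.image G, ⟨?_, ?_⟩, ?_⟩
  · intro q hq i
    obtain ⟨d, -, rfl⟩ := Finset.mem_image.1 hq
    simp only [G]
    positivity
  · rintro θ ⟨⟨h0, h1⟩, hanti⟩
    set J : ℕ → ℕ := fun l => if h : l < k then ⌊√(n * θ ⟨l, h⟩)⌋₊ else 0 with hJdef
    have hJ : Antitone J := by
      intro a b hab
      simp only [hJdef]
      split_ifs with hb ha ha
      · refine Nat.floor_mono (Real.sqrt_le_sqrt (mul_le_mul_of_nonneg_left ?_ hn'.le))
        exact hanti hab
      · omega
      · exact Nat.zero_le _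
      · exact le_rfl
    have hJk : J k = 0 := by simp [hJdef]
    have hJi (i : Fin k) : J i = ⌊√(n * θ i)⌋₊ := by simp [hJdef]
    set d : Fin k → ℕ := fun l => J l - J (l + 1) with hd
    have hsum (i : Fin k) : (∑ l : Fin k, if (i : ℕ) ≤ l then d l else 0) = J i := by
      have h := sum_range_ite_sub_of_antitone hJ i k
      rw [max_eq_right i.2.le, hJk, Nat.sub_zero] at h
      rw [← h, ← Fin.sum_univ_eq_sum_range (fun l => if (i : ℕ) ≤ l then J l - J (l + 1) else 0)]
    refine ⟨G d, Finset.mem_image_of_mem _ (Finset.mem_filter.2 ⟨?_, ?_⟩), 1, one_pos, ?_⟩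
    · rw [Fintype.mem_piFinset]
      intro i
      rw [Finset.mem_range, Nat.lt_succ_iff]
      refine (Nat.sub_le _ _).trans ?_
      rw [hJi]
      refine Nat.floor_mono (Real.sqrt_le_sqrt (mul_le_of_le_one_right hn'.le ?_))
      exact h1 ▸ Finset.single_le_sum (fun i _ => h0 i) (Finset.mem_univ i)
    · have hswap : ∑ l : Fin k, ((l : ℕ) + 1) * d l = ∑ i : Fin k, J i := by
        simp only [← hsum]
        rw [Finset.sum_comm]
        refine Finset.sum_congr rfl fun l _ => ?_
        rw [← Finset.sum_filter, Finset.sum_const, smul_eq_mul]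
        congr 1
        have : (Finset.univ.filter fun i : Fin k => (i : ℕ) ≤ l) = Finset.Iic l := by
          ext i
          simp
        rw [this, Fin.card_Iic]
      have hswap' : ∑ l : Fin k, ((l : ℕ) + 1 : ℝ) * d l = ∑ i : Fin k, (J i : ℝ) := by
        exact_mod_cast hswap
      rw [hswap']
      refine (Finset.sum_le_sum (g := fun i => √(n * θ i)) fun i _ => ?_).trans ?_
      · rw [hJi]
        exact Nat.floor_le (Real.sqrt_nonneg _)
      -- Cauchy–Schwarz, with `∑ θ i = 1`.
      · refine Real.le_sqrt_of_sq_le ?_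
        refine (sq_sum_le_card_mul_sum_sq).trans_eq ?_
        have hsq (i) : √(n * θ i) ^ 2 = n * θ i := Real.sq_sqrt (mul_nonneg hn'.le (h0 i))
        simp only [hsq, ← Finset.mul_sum, h1]
        simp
    · have hterm (i : Fin k) : (θ i - 1 * G d i) ^ 2 / (1 * G d i) ≤ 4 / n := by
        simp only [G, hsum, hJi, one_mul]
        exact sq_sub_div_grid_le (θ i) n (h0 i) hn'
      have h := Finset.sum_le_sum fun i (_ : i ∈ Finset.univ) => hterm i
      simp only [Finset.sum_const, Finset.card_univ, Fintype.card_fin, nsmul_eq_mul] at h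
      rw [show (4 * k / n : ℝ) = k * (4 / n) by ring]
      exact h
  · refine le_trans ?_ (card_partitions_le k (⌊√(n : ℝ)⌋₊ + 1) (√(k * n)) hk hS)
    exact Nat.cast_le.2 Finset.card_image_le

/-- The letters above a given level form an initial segment, so its length, one of `k + 1` values,
records them. Rounding up to the next level has relative error at most `γ`, contributing `γ ^ 2 θ
i`; an entry at most `τ` is rounded to `τ` and contributes at most `τ`. -/
theorem exists_chiSqCover_of_levels (k B : ℕ) (γ τ : ℝ) (hγ : 0 < γ) (hτ : 0 < τ)
    (hB : 1 ≤ τ * (1 + γ) ^ B) :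
    ∃ F : Finset (Fin k → ℝ), IsChiSqCover F (γ ^ 2 + k * τ) ∧
      (F.card : ℝ) ≤ ((k : ℝ) + 1) ^ B := by
  classical
  let N : (Fin B → ℕ) → Fin k → ℕ := fun t i => (Finset.univ.filter fun b => (i : ℕ) < t b).card
  let G : (Fin B → ℕ) → Fin k → ℝ := fun t i => τ * (1 + γ) ^ N t i
  refine ⟨(Fintype.piFinset fun _ : Fin B => Finset.range (k + 1)).image G, ⟨?_, ?_⟩, ?_⟩
  · intro q hq i
    obtain ⟨t, -, rfl⟩ := Finset.mem_image.1 hq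
    simp only [G]
    positivity
  · rintro θ ⟨⟨h0, h1⟩, hanti⟩
    have hθ1 (i) : θ i ≤ 1 := h1 ▸ Finset.single_le_sum (fun i _ => h0 i) (Finset.mem_univ i)
    set t : Fin B → ℕ := fun b =>
      (Finset.univ.filter fun i : Fin k => τ * (1 + γ) ^ (b : ℕ) < θ i).card with ht
    have hlt (i : Fin k) (b : Fin B) : (i : ℕ) < t b ↔ τ * (1 + γ) ^ (b : ℕ) < θ i := by
      constructor
      · intro h
        by_contra hcon
        have hsub : (Finset.univ.filter fun j : Fin k => τ * (1 + γ) ^ (b : ℕ) < θ j)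
            ⊆ Finset.Iio i := by
          intro j hj
          rw [Finset.mem_filter] at hj
          rw [Finset.mem_Iio]
          by_contra hij
          exact hcon (hj.2.trans_le (hanti (not_lt.1 hij)))
        have := Finset.card_le_card hsub
        rw [Fin.card_Iio] at this
        simp only [ht] at h
        omega
      · intro h
        have hsub : Finset.Iic i
            ⊆ (Finset.univ.filter fun j : Fin k => τ * (1 + γ) ^ (b : ℕ) < θ j) := by
          intro j hj
          rw [Finset.mem_filter]
          exact ⟨Finset.mem_univ _, h.trans_le (hanti (Finset.mem_Iic.1 hj))⟩
        have := Finset.card_le_card hsub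
        rw [Fin.card_Iic] at this
        exact this
    refine ⟨G t, Finset.mem_image_of_mem _ ?_, 1, one_pos, ?_⟩
    · rw [Fintype.mem_piFinset]
      intro b
      rw [Finset.mem_range, Nat.lt_succ_iff]
      exact (Finset.card_le_univ _).trans_eq (Fintype.card_fin k)
    · have hex (i : Fin k) : ∃ m, θ i ≤ τ * (1 + γ) ^ m := ⟨B, (hθ1 i).trans hB⟩
      have hmono {a b : ℕ} (h : a ≤ b) : τ * (1 + γ) ^ a ≤ τ * (1 + γ) ^ b := by
        gcongr
        linarith
      -- The number of levels strictly below `θ i` is the index of the first level that reaches it.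
      have hN (i : Fin k) : N t i = Nat.find (hex i) := by
        have hle : Nat.find (hex i) ≤ B := Nat.find_min' _ ((hθ1 i).trans hB)
        have hset : (Finset.univ.filter fun b : Fin B => (i : ℕ) < t b)
            = Finset.univ.filter fun b : Fin B => (b : ℕ) < Nat.find (hex i) := by
          refine Finset.filter_congr fun b _ => ?_
          rw [hlt]
          constructor
          · intro h
            by_contra hcon
            exact absurd (h.trans_le (Nat.find_spec (hex i))) (not_lt.2 (hmono (not_lt.1 hcon)))
          · intro h
            exact not_le.1 (Nat.find_min (hex i) h)
        simp only [N, hset]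
        rw [Fin.card_filter_val_lt, min_eq_right hle]
      have hterm (i : Fin k) : (θ i - 1 * G t i) ^ 2 / (1 * G t i) ≤ γ ^ 2 * θ i + τ := by
        simp only [G, hN, one_mul]
        have hspec := Nat.find_spec (hex i)
        rcases Nat.eq_zero_or_pos (Nat.find (hex i)) with hz | hz
        · rw [hz, pow_zero, mul_one] at hspec ⊢
          rw [div_le_iff₀ hτ]
          have := h0 i
          have : 0 ≤ γ ^ 2 * θ i * τ := by positivity
          nlinarith
        · have hmin := not_le.1 (Nat.find_min (hex i) (Nat.sub_lt hz one_pos))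
          set m := Nat.find (hex i) with hm
          have hsucc : τ * (1 + γ) ^ m = (1 + γ) * (τ * (1 + γ) ^ (m - 1)) := by
            conv_lhs => rw [← Nat.sub_add_cancel hz, pow_succ]
            ring
          have hQ : 0 < τ * (1 + γ) ^ m := by positivity
          set Q := τ * (1 + γ) ^ m with hQdef
          have hQle : Q - θ i ≤ γ * θ i := by nlinarith
          have h2 : (θ i - Q) ^ 2 ≤ γ ^ 2 * θ i * θ i := by nlinarith
          have h3 : (θ i - Q) ^ 2 / Q ≤ γ ^ 2 * θ i := by
            rw [div_le_iff₀ hQ]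
            have := h0 i
            exact h2.trans (by gcongr)
          linarith
      refine (Finset.sum_le_sum fun i _ => hterm i).trans_eq ?_
      rw [Finset.sum_add_distrib, ← Finset.mul_sum, h1]
      simp
  · have h := Finset.card_image_le (s := Fintype.piFinset fun _ : Fin B =>
      Finset.range (k + 1)) (f := G)
    simp only [Fintype.card_piFinset, Finset.card_range, Finset.prod_const, Finset.card_univ,
      Fintype.card_fin] at h
    exact_mod_cast h

/-! ### Bit costs of the three covers -/

/-- Monotonic sources over `k` letters have a cover which yields codes for sequences of length `n`
with total redundancy at most `b` bits. -/
def HasCoverCost (n k : ℕ) (b : ℝ) : Prop :=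
  ∃ (F : Finset (Fin k → ℝ)) (δ : ℝ), IsChiSqCover F δ ∧ (F.Nonempty →
    3 + Real.logb 2 (k * (k + 1)) + Real.logb 2 F.card + n / Real.log 2 * δ ≤ b)

theorem BlockCode.exists_redundancy_le_of_hasCoverCost {n : ℕ} (hn : 0 < n) (K : ℕ) (b : ℕ → ℝ)
    (hb : ∀ k, 1 ≤ k → k ≤ K → HasCoverCost n k (b k)) :
    ∃ C : BlockCode n, ∀ k, k ≤ K → ∀ θ ∈ MonotonicSources k, n * redundancy C θ ≤ b k := by
  have h (k : ℕ) : ∃ F : Finset (Fin k → ℝ), (∀ q ∈ F, ∀ i, 0 < q i) ∧ (1 ≤ k → k ≤ K →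
      ∃ δ : ℝ, IsChiSqCover F δ ∧ (F.Nonempty →
        3 + Real.logb 2 (k * (k + 1)) + Real.logb 2 F.card + n / Real.log 2 * δ ≤ b k)) := by
    by_cases hk : 1 ≤ k ∧ k ≤ K
    · obtain ⟨F, δ, hF, hle⟩ := hb k hk.1 hk.2
      exact ⟨F, hF.1, fun _ _ => ⟨δ, hF, hle⟩⟩
    · exact ⟨∅, by simp, fun h1 h2 => absurd ⟨h1, h2⟩ hk⟩
  choose F hpos hF using h
  obtain ⟨C, hC⟩ := BlockCode.exists_redundancy_le hn K F hpos
  refine ⟨C, fun k hk θ hθ => ?_⟩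
  have hk1 : 1 ≤ k := by
    by_contra h
    obtain rfl : k = 0 := by omega
    simpa using hθ.1.2
  obtain ⟨δ, hcov, hle⟩ := hF k hk1 hk
  obtain ⟨q, hq, c, hc, herr⟩ := hcov.2 θ hθ
  refine (hC k hk q hq c hc θ hθ.1).trans (le_trans ?_ (hle ⟨q, hq⟩))
  have hl2 : 0 < Real.log 2 := Real.log_pos (by norm_num)
  gcongr

theorem logb_two_mul_succ_le (k : ℕ) (hk : 0 < k) : Real.logb 2 (k * (k + 1)) ≤ 2 * k := by
  have hk' : (0 : ℝ) < k := by exact_mod_cast hk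
  have h : ((k : ℝ) + 1) ≤ 2 ^ k := by exact_mod_cast Nat.lt_two_pow_self (n := k)
  rw [Real.logb_le_iff_le_rpow (by norm_num) (by positivity)]
  calc (k : ℝ) * (k + 1) ≤ 2 ^ k * 2 ^ k := by gcongr; linarith
    _ = 2 ^ (2 * k : ℝ) := by
      rw [← pow_add, ← Real.rpow_natCast]
      push_cast
      ring_nf

theorem four_div_log_two_le : 4 / Real.log 2 ≤ 6 := by
  have := Real.log_two_gt_d9
  rw [div_le_iff₀ (by linarith)]
  linarith

theorem hasCoverCost_of_fixed_dimension (n k : ℕ) (hn : 0 < n) (hk : 2 ≤ k) :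
    HasCoverCost n k (((k : ℝ) - 1) / 2 * (Real.logb 2 n + 28)) := by
  obtain ⟨m, rfl⟩ : ∃ m, k = m + 1 := ⟨k - 1, by omega⟩
  have hm : (1 : ℝ) ≤ m := by exact_mod_cast (show 1 ≤ m by omega)
  have hn' : (1 : ℝ) ≤ n := by exact_mod_cast hn
  obtain ⟨F, hF, hcard⟩ := exists_chiSqCover_of_fixed_dimension m n hn
  refine ⟨F, _, hF, fun hne => ?_⟩
  have h1 := logb_two_mul_succ_le (m + 1) (by omega)
  have hsqrt : 1 ≤ √(n : ℝ) := Real.one_le_sqrt.2 hn'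
  have h2 : Real.logb 2 F.card ≤ m * (Real.logb 2 n / 2 + 1) := by
    refine (Real.logb_le_logb_of_le (by norm_num) (by exact_mod_cast hne.card_pos)
      hcard).trans ?_
    rw [Real.logb_pow]
    gcongr
    calc Real.logb 2 (√(n : ℝ) + 1) ≤ Real.logb 2 (√(n : ℝ) * 2) :=
          Real.logb_le_logb_of_le (by norm_num) (by positivity) (by linarith)
      _ = _ := by
          rw [Real.logb_mul (by positivity) (by norm_num), Real.logb_self_eq_one (by norm_num),
            Real.sqrt_eq_rpow, Real.logb_rpow_eq_mul_logb_of_pos (by positivity)]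
          ring
  have h3 : n / Real.log 2 * (4 * m / n) ≤ 6 * m := by
    have : n / Real.log 2 * (4 * m / n) = 4 / Real.log 2 * m := by field_simp
    rw [this]
    gcongr
    exact four_div_log_two_le
  -- The constants add up to `3 + 2 (m + 1) + m + 6 m ≤ 14 m`, using `m ≥ 1`.
  push_cast at h1 ⊢
  linarith

theorem hasCoverCost_of_cube_le (n k : ℕ) (hk : 0 < k) (hkn : k ^ 3 ≤ n) :
    HasCoverCost n k ((k : ℝ) / 2 * (Real.logb 2 (n / (k : ℝ) ^ 3) + 30)) := by
  have hk' : (1 : ℝ) ≤ k := by exact_mod_cast hk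
  have hn : 0 < n := lt_of_lt_of_le (by positivity) hkn
  have hn' : (0 : ℝ) < n := by exact_mod_cast hn
  obtain ⟨F, hF, hcard⟩ := exists_chiSqCover_of_cube_le k n hk hkn
  refine ⟨F, _, hF, fun hne => ?_⟩
  have h1 := logb_two_mul_succ_le k hk
  have h2 : Real.logb 2 F.card ≤ k * (Real.logb 2 (n / (k : ℝ) ^ 3) / 2 + 4) := by
    refine (Real.logb_le_logb_of_le (by norm_num) (by exact_mod_cast hne.card_pos)
      hcard).trans ?_
    rw [Real.logb_pow]
    gcongr
    have hsq : √(k * n) / (k : ℝ) ^ 2 = √(n / (k : ℝ) ^ 3) := by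
      rw [show (n / (k : ℝ) ^ 3) = k * n / ((k : ℝ) ^ 2) ^ 2 by field_simp,
        Real.sqrt_div' _ (by positivity), Real.sqrt_sq (by positivity)]
    have he : Real.exp 2 ≤ 8 := by
      have h := Real.exp_one_lt_d9
      have h0 := Real.exp_pos 1
      rw [show (2 : ℝ) = 1 + 1 by norm_num, Real.exp_add]
      nlinarith
    rw [hsq, Real.logb_mul (by positivity) (by positivity), Real.sqrt_eq_rpow,
      Real.logb_rpow_eq_mul_logb_of_pos (by positivity)]
    have h16 : Real.logb 2 (2 * Real.exp 2) ≤ 4 := by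
      rw [Real.logb_le_iff_le_rpow (by norm_num) (by positivity)]
      norm_num
      linarith
    linarith
  have h3 : n / Real.log 2 * (4 * k / n) ≤ 6 * k := by
    have : n / Real.log 2 * (4 * k / n) = 4 / Real.log 2 * k := by field_simp
    rw [this]
    gcongr
    exact four_div_log_two_le
  -- Here they add up to `3 + 2 k + 4 k + 6 k ≤ 15 k`.
  linarith

/-- With `γ = Γ n^{-1/3}` both the level count, of order `log n / γ`, and the error `n γ ^ 2` scale
as `n^{1/3}`. The floor `τ = n ^ (-3)` makes `n k τ ≤ 1` for `k ≤ n ^ 2`. -/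
theorem hasCoverCost_of_le_sq (n k : ℕ) (Γ : ℝ) (hn : 2 ≤ n) (hk : 0 < k) (hkn : k ≤ n ^ 2)
    (hΓ : 0 < Γ) (hΓn : Γ ≤ (n : ℝ) ^ (1 / 3 : ℝ)) :
    HasCoverCost n k ((n : ℝ) ^ (1 / 3 : ℝ) * (18 / Γ * Real.logb 2 n ^ 2 + 13 * Real.logb 2 n
      + 2 * Γ ^ 2)) := by
  have hn2 : (2 : ℝ) ≤ n := by exact_mod_cast hn
  have hn0 : (0 : ℝ) < n := by linarith
  have hk' : (1 : ℝ) ≤ k := by exact_mod_cast hk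
  have hkn' : (k : ℝ) ≤ n ^ 2 := by exact_mod_cast hkn
  set r : ℝ := (n : ℝ) ^ (1 / 3 : ℝ) with hr
  have hr1 : 1 ≤ r := Real.one_le_rpow (by linarith) (by norm_num)
  have hr3 : r ^ 3 = n := by
    rw [hr, ← Real.rpow_natCast, ← Real.rpow_mul hn0.le]
    norm_num
  set ℓ := Real.logb 2 n with hℓ
  have hℓ1 : 1 ≤ ℓ := by
    rw [hℓ, Real.le_logb_iff_rpow_le (by norm_num) hn0]
    simpa using hn2
  have hlog2 := Real.log_two_gt_d9
  have hlog2' := Real.log_two_lt_d9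
  have hlnn : Real.log n ≤ ℓ := by
    rw [hℓ, Real.logb, le_div_iff₀ (by linarith)]
    have : 0 ≤ Real.log n := Real.log_nonneg (by linarith)
    nlinarith
  set γ := Γ / r with hγ
  have hγ0 : 0 < γ := by positivity
  have hγ1 : γ ≤ 1 := (div_le_one (by positivity)).2 hΓn
  -- Since `log (1 + γ) ≥ γ / 2` for `γ ≤ 1`, this many levels climb from `n ^ (-3)` to `1`.
  set B := ⌈6 * Real.log n / γ⌉₊ with hB
  have hB1 : 6 * Real.log n / γ ≤ B := Nat.le_ceil _
  have hB2 : (B : ℝ) ≤ 6 * ℓ * r / Γ + 1 := by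
    have h := Nat.ceil_lt_add_one (a := 6 * Real.log n / γ)
      (div_nonneg (mul_nonneg (by norm_num) (Real.log_nonneg (by linarith))) hγ0.le)
    refine h.le.trans ?_
    have : 6 * Real.log n / γ = 6 * Real.log n * r / Γ := by
      rw [hγ]
      field_simp
    rw [this]
    gcongr
  have hcover : 1 ≤ 1 / (n : ℝ) ^ 3 * (1 + γ) ^ B := by
    rw [one_div_mul_eq_div, one_le_div (by positivity)]
    have hlog : γ / 2 ≤ Real.log (1 + γ) := by
      have h := Real.one_sub_inv_le_log_of_pos (show 0 < 1 + γ by linarith)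
      refine le_trans ?_ h
      have : 1 - (1 + γ)⁻¹ = γ / (1 + γ) := by field_simp; ring
      rw [this]
      gcongr
      linarith
    rw [← Real.log_le_log_iff (by positivity) (by positivity), Real.log_pow, Real.log_pow]
    rw [div_le_iff₀ hγ0] at hB1
    have : (B : ℝ) * (γ / 2) ≤ B * Real.log (1 + γ) := by gcongr
    push_cast
    linarith
  obtain ⟨F, hF, hcard⟩ := exists_chiSqCover_of_levels k B γ (1 / (n : ℝ) ^ 3) hγ0
    (by positivity) hcover
  refine ⟨F, _, hF, fun hne => ?_⟩
  have hk1 : (k : ℝ) + 1 ≤ (n : ℝ) ^ 3 := by nlinarith [sq_nonneg ((n : ℝ) - 1)]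
  have hlk : Real.logb 2 ((k : ℝ) + 1) ≤ 3 * ℓ := by
    refine (Real.logb_le_logb_of_le (by norm_num) (by positivity) hk1).trans_eq ?_
    rw [Real.logb_pow, hℓ]
    norm_num
  have h1 : Real.logb 2 (k * (k + 1)) ≤ 5 * ℓ := by
    rw [Real.logb_mul (by positivity) (by positivity)]
    have : Real.logb 2 (k : ℝ) ≤ 2 * ℓ := by
      refine (Real.logb_le_logb_of_le (by norm_num) (by positivity) hkn').trans_eq ?_
      rw [Real.logb_pow, hℓ]
      norm_num
    linarith
  have h2 : Real.logb 2 F.card ≤ (6 * ℓ * r / Γ + 1) * (3 * ℓ) := by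
    refine (Real.logb_le_logb_of_le (by norm_num) (by exact_mod_cast hne.card_pos)
      hcard).trans ?_
    rw [Real.logb_pow]
    gcongr
    exact Real.logb_nonneg (by norm_num) (by linarith)
  have h3 : n / Real.log 2 * (γ ^ 2 + k * (1 / (n : ℝ) ^ 3)) ≤ 2 * Γ ^ 2 * r + 2 := by
    have ha : n * γ ^ 2 = Γ ^ 2 * r := by
      rw [hγ, ← hr3]
      field_simp
    have hb : n * (k * (1 / (n : ℝ) ^ 3)) ≤ 1 := by
      have : n * (k * (1 / (n : ℝ) ^ 3)) = k / (n : ℝ) ^ 2 := by field_simp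
      rw [this, div_le_one (by positivity)]
      exact hkn'
    rw [div_mul_eq_mul_div, mul_add, ha, div_le_iff₀ (by linarith)]
    have : 0 ≤ Γ ^ 2 * r := by positivity
    nlinarith
  have h4 : (6 * ℓ * r / Γ + 1) * (3 * ℓ) = r * (18 / Γ * ℓ ^ 2) + 3 * ℓ := by
    field_simp
    ring
  have h5 : 13 * ℓ ≤ r * (13 * ℓ) := le_mul_of_one_le_left (by positivity) hr1
  linarith

/-! ### One code for all regimes, and the theorem -/

theorem eventually_le_logb_two_natCast (X : ℝ) : ∀ᶠ n : ℕ in atTop, X ≤ Real.logb 2 (n : ℝ) :=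
  ((Real.tendsto_logb_atTop (by norm_num)).comp tendsto_natCast_atTop_atTop).eventually_ge_atTop X

theorem eventually_le_natCast_rpow (X : ℝ) :
    ∀ᶠ n : ℕ in atTop, X ≤ (n : ℝ) ^ (1 / 3 : ℝ) :=
  ((tendsto_rpow_atTop (by norm_num)).comp tendsto_natCast_atTop_atTop).eventually_ge_atTop X

theorem exists_universal_codes (K : ℕ) (η : ℝ) (hη : 0 < η) :
    ∃ C : (n : ℕ) → BlockCode n, ∀ᶠ n : ℕ in atTop, ∀ k ≤ n ^ 2, ∀ θ ∈ MonotonicSources k,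
      (2 ≤ k → k ≤ K →
        n * redundancy (C n) θ ≤ ((k : ℝ) - 1) / 2 * (Real.logb 2 n + 28)) ∧
      (K < k → k ^ 3 ≤ n →
        n * redundancy (C n) θ ≤ (k : ℝ) / 2 * (Real.logb 2 (n / (k : ℝ) ^ 3) + 30)) ∧
      (K < k → n < k ^ 3 →
        n * redundancy (C n) θ ≤ η * Real.logb 2 n ^ 2 * (n : ℝ) ^ (1 / 3 : ℝ)) := by
  -- Then `18 / Γ = η / 2`; the other half of `η` absorbs the lower-order terms for large `n`.
  set Γ := 36 / η with hΓ
  have hΓ0 : 0 < Γ := by positivity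
  have h (n : ℕ) : ∃ C : BlockCode n, 2 ≤ n → Γ ≤ (n : ℝ) ^ (1 / 3 : ℝ) →
      2 * (13 + 2 * Γ ^ 2) / η + 1 ≤ Real.logb 2 (n : ℝ) →
      ∀ k ≤ n ^ 2, ∀ θ ∈ MonotonicSources k,
      (2 ≤ k → k ≤ K →
        n * redundancy C θ ≤ ((k : ℝ) - 1) / 2 * (Real.logb 2 n + 28)) ∧
      (K < k → k ^ 3 ≤ n →
        n * redundancy C θ ≤ (k : ℝ) / 2 * (Real.logb 2 (n / (k : ℝ) ^ 3) + 30)) ∧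
      (K < k → n < k ^ 3 →
        n * redundancy C θ ≤ η * Real.logb 2 n ^ 2 * (n : ℝ) ^ (1 / 3 : ℝ)) := by
    by_cases hn : 2 ≤ n ∧ Γ ≤ (n : ℝ) ^ (1 / 3 : ℝ) ∧
      2 * (13 + 2 * Γ ^ 2) / η + 1 ≤ Real.logb 2 (n : ℝ)
    · obtain ⟨hn2, hΓn, hℓ⟩ := hn
      set ℓ := Real.logb 2 (n : ℝ) with hℓdef
      have hX : 0 < 2 * (13 + 2 * Γ ^ 2) / η := by positivity
      have hcost : (n : ℝ) ^ (1 / 3 : ℝ) * (18 / Γ * ℓ ^ 2 + 13 * ℓ + 2 * Γ ^ 2)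
          ≤ η * ℓ ^ 2 * (n : ℝ) ^ (1 / 3 : ℝ) := by
        have h18 : 18 / Γ = η / 2 := by
          rw [hΓ]
          field_simp
          norm_num
        have h1 : 2 * (13 + 2 * Γ ^ 2) / η ≤ ℓ := by linarith
        rw [div_le_iff₀ hη] at h1
        have h2 : 2 * Γ ^ 2 ≤ 2 * Γ ^ 2 * ℓ := le_mul_of_one_le_right (by positivity) (by linarith)
        have h3 : 2 * (13 + 2 * Γ ^ 2) * ℓ ≤ ℓ * η * ℓ := by gcongr; linarith
        rw [h18, mul_comm]
        gcongr
        linarith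
      obtain ⟨C, hC⟩ := BlockCode.exists_redundancy_le_of_hasCoverCost (n := n) (by omega) (n ^ 2)
        (fun k => if 2 ≤ k ∧ k ≤ K then ((k : ℝ) - 1) / 2 * (ℓ + 28)
          else if k ^ 3 ≤ n then (k : ℝ) / 2 * (Real.logb 2 (n / (k : ℝ) ^ 3) + 30)
          else η * ℓ ^ 2 * (n : ℝ) ^ (1 / 3 : ℝ)) (by
        intro k hk1 hkn
        split_ifs with hs hc
        · exact hasCoverCost_of_fixed_dimension n k (by omega) hs.1
        · exact hasCoverCost_of_cube_le n k hk1 hc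
        · obtain ⟨F, δ, hF, hle⟩ := hasCoverCost_of_le_sq n k Γ hn2 hk1 hkn hΓ0 hΓn
          exact ⟨F, δ, hF, fun hne => (hle hne).trans hcost⟩)
      refine ⟨C, fun _ _ _ k hk θ hθ => ⟨fun h1 h2 => ?_, fun h1 h2 => ?_, fun h1 h2 => ?_⟩⟩
      · simpa only [h1, h2, and_self, if_true] using hC k hk θ hθ
      · simpa only [not_le.2 h1, and_false, if_false, h2, if_true] using hC k hk θ hθ
      · simpa only [not_le.2 h1, and_false, if_false, not_le.2 h2] using hC k hk θ hθ
    · obtain ⟨C, -⟩ := BlockCode.exists_length_le (n := n) (∅ : Finset (Fin n → ℕ+)) id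
        (fun _ => 0) (by simp) (by simp)
      exact ⟨C, fun h1 h2 h3 => absurd ⟨h1, h2, h3⟩ hn⟩
  choose C hC using h
  refine ⟨C, ?_⟩
  filter_upwards [eventually_ge_atTop 2, eventually_le_natCast_rpow Γ,
    eventually_le_logb_two_natCast (2 * (13 + 2 * Γ ^ 2) / η + 1)] with n h1 h2 h3
  exact hC n h1 h2 h3

theorem natCast_rpow_one_third_pow (n : ℕ) : ((n : ℝ) ^ (1 / 3 : ℝ)) ^ 3 = n := by
  rw [← Real.rpow_natCast, ← Real.rpow_mul (Nat.cast_nonneg n)]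
  norm_num

theorem theorem4 (ε : ℝ) (hε : 0 < ε) :
    ∃ C : (n : ℕ) → BlockCode n,
      (∀ᶠ n : ℕ in atTop, ∀ k : ℕ, 2 ≤ k → (k : ℝ) ≤ (n : ℝ) ^ (1 / 3 : ℝ) →
        ∀ θ ∈ MonotonicSources k,
          redundancy (C n) θ ≤
            (1 + ε) * (((k : ℝ) - 1) / (2 * (n : ℝ))) *
              Real.logb 2 ((n : ℝ) * (Real.logb 2 (n : ℝ)) ^ 2 / (k : ℝ) ^ 3)) ∧
      (∀ k : ℕ → ℕ, (∀ᶠ n : ℕ in atTop, (n : ℝ) ^ (1 / 3 : ℝ) < (k n : ℝ)) →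
        (fun n : ℕ => (k n : ℝ)) =o[atTop] (fun n : ℕ => (n : ℝ)) →
        ∀ᶠ n : ℕ in atTop, ∀ θ ∈ MonotonicSources (k n),
          redundancy (C n) θ ≤
            (1 + ε) * Real.logb 2 (n : ℝ) *
              Real.logb 2 ((k n : ℝ) / (n : ℝ) ^ (1 / 3 - ε : ℝ)) *
              ((n : ℝ) ^ (1 / 3 : ℝ) / (n : ℝ))) ∧
      (∀ k : ℕ → ℕ, (∀ᶠ n : ℕ in atTop, (n : ℝ) ^ (1 / 3 : ℝ) < (k n : ℝ)) →
        (fun n : ℕ => (k n : ℝ)) =O[atTop] (fun n : ℕ => (n : ℝ)) →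
        ∀ᶠ n : ℕ in atTop, ∀ θ ∈ MonotonicSources (k n),
          redundancy (C n) θ ≤
            (1 + ε) * (2 / 3) * (Real.logb 2 (n : ℝ)) ^ 2 *
              ((n : ℝ) ^ (1 / 3 : ℝ) / (n : ℝ))) := by
  -- For `k ≥ (1 + ε) / ε` one has `k ≤ (1 + ε) (k - 1)`, so beyond `K` the factor `k` may replace
  -- `k - 1`.
  set K := ⌈(1 + ε) / ε⌉₊ + 1 with hK
  have hKε : (1 + ε) / ε ≤ K := by
    rw [hK]
    push_cast
    linarith [Nat.le_ceil ((1 + ε) / ε)]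
  -- The bound `η ≤ ε` serves the second statement and `η ≤ 1 / 2 < 2 / 3` the third.
  obtain ⟨C, hC⟩ := exists_universal_codes K (min ε (1 / 2)) (by positivity)
  have hlarge (k : ℕ → ℕ) (hk : ∀ᶠ n : ℕ in atTop, (n : ℝ) ^ (1 / 3 : ℝ) < (k n : ℝ))
      (hkO : (fun n : ℕ => (k n : ℝ)) =O[atTop] (fun n : ℕ => (n : ℝ))) :
      ∀ᶠ n : ℕ in atTop, ∀ θ ∈ MonotonicSources (k n), n * redundancy (C n) θ ≤
        min ε (1 / 2) * Real.logb 2 n ^ 2 * (n : ℝ) ^ (1 / 3 : ℝ) := by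
    obtain ⟨c, hc⟩ := hkO.bound
    filter_upwards [hC, hk, hc, eventually_ge_atTop ⌈c⌉₊, eventually_ge_atTop (K ^ 3)]
      with n hCn hkn hcn hn hnK θ hθ
    have hcube : n < k n ^ 3 := by
      have h := pow_lt_pow_left₀ hkn (by positivity) (three_ne_zero)
      rw [natCast_rpow_one_third_pow] at h
      exact_mod_cast h
    have hKk : K < k n := lt_of_pow_lt_pow_left₀ 3 (Nat.zero_le _) (hnK.trans_lt hcube)
    have hsq : k n ≤ n ^ 2 := by
      simp only [Real.norm_natCast] at hcn
      have h1 : c ≤ n := (Nat.le_ceil c).trans (by exact_mod_cast hn)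
      have h2 : (k n : ℝ) ≤ (n : ℝ) ^ 2 := by
        rw [sq]
        exact hcn.trans (by gcongr)
      exact_mod_cast h2
    exact (hCn (k n) hsq θ hθ).2.2 hKk hcube
  refine ⟨C, ?_, fun k hk hko => ?_, fun k hk hkO => ?_⟩
  · filter_upwards [hC, eventually_ge_atTop 1,
      eventually_le_logb_two_natCast ((28 + (1 + ε) * (3 * Real.logb 2 K)) / ε),
      eventually_le_logb_two_natCast (2 ^ 15)] with n hCn hn1 hlog1 hlog2 k hk2 hkr θ hθ
    have hn0 : (0 : ℝ) < n := by exact_mod_cast hn1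
    have hk2' : (2 : ℝ) ≤ k := by exact_mod_cast hk2
    have hkn : k ^ 3 ≤ n := by
      have h := pow_le_pow_left₀ (by positivity) hkr 3
      rw [natCast_rpow_one_third_pow] at h
      exact_mod_cast h
    have hkn' : (k : ℝ) ^ 3 ≤ n := by exact_mod_cast hkn
    have hksq : k ≤ n ^ 2 :=
      (Nat.le_self_pow three_ne_zero k).trans (hkn.trans (Nat.le_self_pow two_ne_zero n))
    set ℓ := Real.logb 2 (n : ℝ) with hℓ
    have hℓ0 : 0 < ℓ := lt_of_lt_of_le (by positivity) hlog2
    -- The term `2 log log n` in the target then covers the constant `30` of the partition cover.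
    have hloglog : 15 ≤ Real.logb 2 ℓ := by
      rw [Real.le_logb_iff_rpow_le (by norm_num) hℓ0]
      exact_mod_cast hlog2
    have hsplit : Real.logb 2 ((n : ℝ) * ℓ ^ 2 / (k : ℝ) ^ 3)
        = Real.logb 2 (n / (k : ℝ) ^ 3) + 2 * Real.logb 2 ℓ := by
      rw [mul_div_right_comm, Real.logb_mul (by positivity) (by positivity), Real.logb_pow]
      norm_num
    have hA : 0 ≤ Real.logb 2 (n / (k : ℝ) ^ 3) :=
      Real.logb_nonneg (by norm_num) ((one_le_div (by positivity)).2 hkn')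
    refine le_of_mul_le_mul_left ?_ hn0
    have hrhs : n * ((1 + ε) * (((k : ℝ) - 1) / (2 * (n : ℝ))) *
        Real.logb 2 ((n : ℝ) * ℓ ^ 2 / (k : ℝ) ^ 3))
        = (1 + ε) * ((k : ℝ) - 1) / 2 *
          (Real.logb 2 (n / (k : ℝ) ^ 3) + 2 * Real.logb 2 ℓ) := by
      rw [hsplit]
      field_simp
    rw [hrhs]
    rcases le_or_gt k K with hkK | hkK
    · refine ((hCn k hksq θ hθ).1 hk2 hkK).trans ?_
      have hkK' : (k : ℝ) ≤ K := by exact_mod_cast hkK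
      have hlk : Real.logb 2 (k : ℝ) ≤ Real.logb 2 K :=
        Real.logb_le_logb_of_le (by norm_num) (by positivity) hkK'
      rw [Real.logb_div (by positivity) (by positivity), Real.logb_pow]
      rw [div_le_iff₀ hε] at hlog1
      -- For `k ≤ K` the slack `ε log n` pays for both `28` and the bounded loss `3 log k`.
      have hmain : ℓ + 28 ≤ (1 + ε) * (ℓ - (3 : ℕ) * Real.logb 2 k + 2 * Real.logb 2 ℓ) := by
        push_cast
        nlinarith
      have hk1 : 0 ≤ ((k : ℝ) - 1) / 2 := by linarith
      calc ((k : ℝ) - 1) / 2 * (ℓ + 28)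
          ≤ ((k : ℝ) - 1) / 2 * ((1 + ε) * (ℓ - (3 : ℕ) * Real.logb 2 k + 2 * Real.logb 2 ℓ)) := by
            gcongr
        _ = _ := by ring
    · refine ((hCn k hksq θ hθ).2.1 hkK hkn).trans ?_
      have hkK' : (K : ℝ) ≤ k := by exact_mod_cast hkK.le
      have hkε : (1 + ε) / ε ≤ k := hKε.trans hkK'
      rw [div_le_iff₀ hε] at hkε
      have h1 : (k : ℝ) / 2 ≤ (1 + ε) * ((k : ℝ) - 1) / 2 := by linarith
      exact mul_le_mul h1 (by linarith) (by linarith) (by linarith)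
  · filter_upwards [hlarge k hk hko.isBigO, hk, eventually_ge_atTop 1,
      eventually_le_logb_two_natCast 0] with n hn hkn hn1 hℓ θ hθ
    have hn0 : (0 : ℝ) < n := by exact_mod_cast hn1
    -- As `k n > n^{1/3}`, the argument of the logarithm is at least `n ^ ε`.
    have hlog : ε * Real.logb 2 (n : ℝ)
        ≤ Real.logb 2 ((k n : ℝ) / (n : ℝ) ^ (1 / 3 - ε : ℝ)) := by
      rw [← Real.logb_rpow_eq_mul_logb_of_pos hn0]
      refine Real.logb_le_logb_of_le (by norm_num) (by positivity) ?_
      rw [le_div_iff₀ (by positivity), ← Real.rpow_add hn0]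
      rw [show ε + (1 / 3 - ε) = 1 / 3 by ring]
      exact hkn.le
    refine le_of_mul_le_mul_left ((hn θ hθ).trans ?_) hn0
    have hrhs : n * ((1 + ε) * Real.logb 2 (n : ℝ) *
        Real.logb 2 ((k n : ℝ) / (n : ℝ) ^ (1 / 3 - ε : ℝ)) * ((n : ℝ) ^ (1 / 3 : ℝ) / (n : ℝ)))
        = (1 + ε) * Real.logb 2 (n : ℝ) * Real.logb 2 ((k n : ℝ) / (n : ℝ) ^ (1 / 3 - ε : ℝ)) *
          (n : ℝ) ^ (1 / 3 : ℝ) := by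
      field_simp
    rw [hrhs]
    refine mul_le_mul_of_nonneg_right ?_ (by positivity)
    calc min ε (1 / 2) * Real.logb 2 (n : ℝ) ^ 2 ≤ ε * Real.logb 2 (n : ℝ) ^ 2 := by
          gcongr
          exact min_le_left _ _
      _ = 1 * Real.logb 2 (n : ℝ) * (ε * Real.logb 2 (n : ℝ)) := by ring
      _ ≤ _ := by
          gcongr
          linarith
  · filter_upwards [hlarge k hk hkO, eventually_ge_atTop 1] with n hn hn1 θ hθ
    have hn0 : (0 : ℝ) < n := by exact_mod_cast hn1
    refine le_of_mul_le_mul_left ((hn θ hθ).trans ?_) hn0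
    have hrhs : n * ((1 + ε) * (2 / 3) * Real.logb 2 (n : ℝ) ^ 2 *
        ((n : ℝ) ^ (1 / 3 : ℝ) / (n : ℝ)))
        = (1 + ε) * (2 / 3) * Real.logb 2 (n : ℝ) ^ 2 * (n : ℝ) ^ (1 / 3 : ℝ) := by
      field_simp
    rw [hrhs]
    gcongr
    linarith [min_le_right ε (1 / 2 : ℝ)]
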